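/- **Setting.** Let $\mathbf X$ and $\mathbf A$ be Borel spaces (homeomorphic to Borel subsets of Polish spaces) and let $J$ be a natural number. Let $\phi:\mathbf X\times[0,\infty)\to\mathbf X$ be a measurable flow ($\phi(x,0)=x$, $\phi(x,t+s)=\phi(\phi(x,s),t)$), let $l:\mathbf X\times\mathbf A\to\mathbf X$ be measurable, and let $C^g_j:\mathbf X\to[0,\infty)$ and $C^I_j:\mathbf X\times\mathbf A\to[0,\infty)$, $j=0,\dots,J$, be measurable. Fix $x_0\in\mathbf X$ and $d_1,\dots,d_J\in[0,\infty)$. Put $\mathbf X_\Delta=\mathbf X\cup\{\Delta\}$ with an isolated point $\Delta\notin\mathbf X$, and $\mathbf B=[0,\infty]\times\mathbf A$. For $x\in\mathbf X_\Delta$ and $(\theta,a)\in\mathbf B$ let $$Q(dy|x,(\theta,a))=\begin{cases}\delta_{l(\phi(x,\theta),a)}(dy), & x\neq\Delta,\ \theta\ne\infty,\\ \delta_\Delta(dy), &\text{otherwise,}\end{cases}$$ $$\bar C_j(x,(\theta,a))=\mathbb I\{x\ne\Delta\}\Big\{\int_{[0,\theta]}C^g_j(\phi(x,u))\,du+\mathbb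 I\{\theta<\infty\}\,C^I_j(\phi(x,\theta),a)\Big\},$$ where $[0,\theta]$ is replaced by $[0,\infty)$ if $\theta=\infty$. A strategy $\pi=(\pi_i)_{i\ge1}$ is a sequence of stochastic kernels $\pi_i$ on $\mathbf B$ given histories $h_{i-1}=(x_0,b_1,x_1,\dots,b_{i-1},x_{i-1})$. For an initial state $x\in\mathbf X_\Delta$ it defines, by the Ionescu-Tulcea theorem, a probability measure $P^\pi_x$ (with expectation $E^\pi_x$) on trajectories $(X_0,B_1,X_1,B_2,\dots)$ such that $X_0=x$, $B_i$ has conditional law $\pi_i(\cdot|H_{i-1})$ given the history $H_{i-1}=(X_0,B_1,\dots,X_{i-1})$, and $X_i$ has conditional law $Q(\cdot|X_{i-1},B_i)$ given $(H_{i-1},B_i)$. The occupation measure $\mu^\pi$ on $\mathbf X_\Delta\times\mathbf B$ is $\mu^\pi(S)=E^\pi_{x_0}\big[\sum_{n\ge0}\mathbb I\{(X_n,B_{n+1})\in S\}\big]$. A stationary strategy is given by one stochastic kernel $\widetilde\pi(db|x)$ on $\mathbf B$ given $\mathbf X_\Delta$; a measurable map $f:\mathbf X_\Delta\to\mathbf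 B$ is identified with the stationary strategy $\delta_{f(x)}(db)$. With $B_i=(\Theta_i,A_i)$, put $$\mathcal V_j(x_0,\pi)=E^\pi_{x_0}\Big[\sum_{i\ge1}\mathbb I\{X_{i-1}\neq\Delta\}\Big\{\int_{[0,\Theta_i)}C^g_j(\phi(X_{i-1},u))\,du+\mathbb I\{\Theta_i<\infty\}\,C^I_j(\phi(X_{i-1},\Theta_i),A_i)\Big\}\Big].$$ **Assumptions.** (i) There is a strategy $\pi$ with $\mathcal V_j(x_0,\pi)\le d_j$ for $j=1,\dots,J$ and $\mathcal V_0(x_0,\pi)<\infty$. (ii) $\mathbf A$ is compact, $[0,\infty]$ carries the topology of the one-point compactification of $[0,\infty)$, $l$ and $\phi$ are continuous, and all $C^I_j$ and $C^g_j$ are lower semicontinuous. Let $V=\{x\in\mathbf X_\Delta:\inf_\pi E^\pi_x[\sum_{n\ge0}\sum_{j=0}^J\bar C_j(X_n,B_{n+1})]>0\}$ and $V^c=\mathbf X_\Delta\setminus V$. **Proposition.** Let $\mu$ be a $[0,\infty]$-valued measure on $\mathbf X_\Delta\times\mathbf B$ that is feasible with finite value in the linear program, i.e. $$\mu(dx\times\mathbf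 B)=\delta_{x_0}(dx)+\int_{\mathbf X_\Delta\times\mathbf B}Q(dx|y,b)\,\mu(dy\times db),$$ $$\int\bar C_j\,d\mu\le d_j\ (j=1,\dots,J),\qquad \int\bar C_0\,d\mu<\infty.$$ Then $V$ is a Borel set, $\mu$ is $\sigma$-finite on $V\times\mathbf B$, and there is a stochastic kernel $\varphi_\mu$ on $\mathbf B$ given $V$ with $$\varphi_\mu(db|x)\,\mu(dx\times\mathbf B)=\mu(dx\times db)\quad\text{on }\mathcal B(V\times\mathbf B).$$ Moreover, for every such kernel $\varphi_\mu$, and for every measurable $f^*:\mathbf X_\Delta\to\mathbf B$ such that the deterministic stationary strategy $f^*$ attains $\inf_\pi E^\pi_x[\sum_n\sum_j\bar C_j(X_n,B_{n+1})]$ for each $x\in\mathbf X_\Delta$ and such that $Q(V|x,f^*(x))=0$ for all $x\in V^c$, the stationary strategy $$\widetilde\pi_\mu(db|x)=\mathbb I\{x\in V\}\,\varphi_\mu(db|x)+\mathbb I\{x\in V^c\}\,\delta_{f^*(x)}(db)$$ satisfies $\mu^{\widetilde\pi_\mu}(\Gamma\times\mathbf B)\le\mu(\Gamma\times\mathbf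 B)$ for all $\Gamma\in\mathcal B(V)$. -/

import Mathlib

open MeasureTheory ProbabilityTheory Set Topology
open scoped NNReal ENNReal

noncomputable section

namespace ImpulseControl

universe u v

/-- A Borel space: a topological space homeomorphic to a Borel subset of a Polish space. -/
def IsBorelSpace (X : Type u) [TopologicalSpace X] : Prop :=
  ∃ (P : Type u) (_ : TopologicalSpace P) (_ : PolishSpace P) (e : X → P),
    IsEmbedding e ∧ MeasurableSet[borel P] (range e)

/-- The state space with the isolated cemetery `Δ = Sum.inr ()` added. -/
abbrev XΔ (X : Type u) : Type u := X ⊕ Unit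

/-- The space of controls `(θ, a)`: waiting time `θ ∈ [0, ∞]` and impulse `a ∈ A`. -/
abbrev Ctrl (A : Type v) : Type v := ℝ≥0∞ × A

/-- An impulse control model with gradual cost rates and impulse costs indexed by `0, …, J`. -/
structure Model (X : Type u) (A : Type v) [MeasurableSpace X] [MeasurableSpace A] (J : ℕ) where
  flow : X → ℝ≥0 → X
  measurable_flow : Measurable fun p : X × ℝ≥0 => flow p.1 p.2
  flow_add : ∀ x t s, flow x (t + s) = flow (flow x s) t
  flow_zero : ∀ x, flow x 0 = x
  impulse : X → A → X
  measurable_impulse : Measurable fun p : X × A => impulse p.1 p.2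
  Cg : Fin (J + 1) → X → ℝ≥0
  measurable_Cg : ∀ j, Measurable (Cg j)
  CI : Fin (J + 1) → X → A → ℝ≥0
  measurable_CI : ∀ j, Measurable fun p : X × A => CI j p.1 p.2

/-- The compactness-continuity condition. The topology of `ℝ≥0∞` is that of the one-point
compactification of `[0, ∞)`. -/
structure Model.CompactContinuous {X : Type u} {A : Type v} [TopologicalSpace X]
    [MeasurableSpace X] [TopologicalSpace A] [MeasurableSpace A] {J : ℕ} (M : Model X A J) :
    Prop where
  compact : CompactSpace A
  continuous_impulse : Continuous fun p : X × A => M.impulse p.1 p.2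
  continuous_flow : Continuous fun p : X × ℝ≥0 => M.flow p.1 p.2
  lsc_CI : ∀ j, LowerSemicontinuous fun p : X × A => M.CI j p.1 p.2
  lsc_Cg : ∀ j, LowerSemicontinuous (M.Cg j)

/-- Histories `h_n = (x_0, b_1, x_1, …, b_n, x_n)`: the pairs `(x_i, b_{i+1})` for `i < n`,
followed by the current state `x_n`. -/
abbrev Hist (X : Type u) (A : Type v) (n : ℕ) : Type (max u v) :=
  (Fin n → XΔ X × Ctrl A) × XΔ X

/-- A (randomized, history-dependent) strategy: `kernel n` is the conditional law of the control
`b_{n+1}` given the history `h_n`. -/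
structure Strategy (X : Type u) (A : Type v) [MeasurableSpace X] [MeasurableSpace A] where
  kernel : (n : ℕ) → Kernel (Hist X A n) (Ctrl A)
  markov : ∀ n, IsMarkovKernel (kernel n)

attribute [instance] Strategy.markov

section

variable {X : Type u} {A : Type v} [MeasurableSpace X] [MeasurableSpace A] {J : ℕ}

/-- The stationary strategy given by a stochastic kernel on controls given the current state. -/
def Strategy.stationary (κ : Kernel (XΔ X) (Ctrl A)) [IsMarkovKernel κ] : Strategy X A where
  kernel _ := κ.comap Prod.snd measurable_snd
  markov _ := inferInstance

/-- The deterministic stationary strategy given by a measurable map. -/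
def Strategy.deterministic (f : XΔ X → Ctrl A) (hf : Measurable f) : Strategy X A :=
  Strategy.stationary (Kernel.deterministic f hf)

namespace Model

variable (M : Model X A J)

/-- The next state after the control `(θ, a)` is chosen in the current state. -/
def next : XΔ X × Ctrl A → XΔ X
  | (Sum.inl x, b) => if b.1 = ∞ then Sum.inr () else Sum.inl (M.impulse (M.flow x b.1.toNNReal) b.2)
  | (Sum.inr _, _) => Sum.inr ()

theorem measurable_next : Measurable M.next := by
  have h : Measurable (M.next ∘ (MeasurableEquiv.sumProdDistrib X Unit (Ctrl A)).symm) := by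
    refine measurable_fun_sum ?_ ?_
    · change Measurable fun p : X × Ctrl A => if p.2.1 = ∞ then (Sum.inr () : XΔ X)
        else Sum.inl (M.impulse (M.flow p.1 p.2.1.toNNReal) p.2.2)
      refine Measurable.ite (measurable_snd.fst (measurableSet_singleton ∞)) measurable_const ?_
      have h1 : Measurable fun p : X × Ctrl A => M.flow p.1 p.2.1.toNNReal :=
        M.measurable_flow.comp (measurable_fst.prodMk measurable_snd.fst.ennreal_toNNReal)
      exact measurable_inl.comp (M.measurable_impulse.comp (h1.prodMk measurable_snd.snd))
    · exact measurable_const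
  simpa [Function.comp_assoc] using
    h.comp (MeasurableEquiv.sumProdDistrib X Unit (Ctrl A)).measurable

/-- The transition kernel `Q(dy | x, b)`, a Dirac measure at the next state. -/
def Q : Kernel (XΔ X × Ctrl A) (XΔ X) := Kernel.deterministic M.next M.measurable_next

instance : IsMarkovKernel M.Q := by unfold Q; infer_instance

/-- The cost `∫_{[0,θ)} C^g_j(φ(x,u)) du + 𝕀{θ < ∞} C^I_j(φ(x,θ),a)` of one step
(zero in the cemetery). -/
def stepCost (j : Fin (J + 1)) : XΔ X × Ctrl A → ℝ≥0∞
  | (Sum.inl x, b) => (∫⁻ t in {t : ℝ | 0 ≤ t ∧ ENNReal.ofReal t < b.1},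
        (M.Cg j (M.flow x t.toNNReal) : ℝ≥0∞)) +
      if b.1 < ∞ then (M.CI j (M.flow x b.1.toNNReal) b.2 : ℝ≥0∞) else 0
  | (Sum.inr _, _) => 0

/-- The cost function `C̄_j` of the Markov decision process, with the integral over `[0,θ]`
(over `[0,∞)` if `θ = ∞`). -/
def cost (j : Fin (J + 1)) : XΔ X × Ctrl A → ℝ≥0∞
  | (Sum.inl x, b) => (∫⁻ t in {t : ℝ | 0 ≤ t ∧ ENNReal.ofReal t ≤ b.1},
        (M.Cg j (M.flow x t.toNNReal) : ℝ≥0∞)) +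
      if b.1 < ∞ then (M.CI j (M.flow x b.1.toNNReal) b.2 : ℝ≥0∞) else 0
  | (Sum.inr _, _) => 0

/-- The history `h_{n+1}` made of `(x_0, b_1), …, (x_n, b_{n+1})` and the new state `x_{n+1}`. -/
def toHist (n : ℕ) (p : (Finset.Iic n → XΔ X × Ctrl A) × XΔ X) : Hist X A (n + 1) :=
  (fun i => p.1 ⟨i, Finset.mem_Iic.2 (Nat.lt_succ_iff.1 i.2)⟩, p.2)

theorem measurable_toHist (n : ℕ) : Measurable (toHist (X := X) (A := A) n) := by
  unfold toHist
  fun_prop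

/-- The conditional law of `(x_{n+1}, b_{n+2})` given `(x_0, b_1), …, (x_n, b_{n+1})`:
`x_{n+1}` has law `Q(· | x_n, b_{n+1})`, and `b_{n+2}` is chosen by the strategy. -/
def transition (π : Strategy X A) (n : ℕ) :
    Kernel (Finset.Iic n → XΔ X × Ctrl A) (XΔ X × Ctrl A) :=
  (M.Q.comap (fun z => z ⟨n, Finset.mem_Iic.2 le_rfl⟩) (measurable_pi_apply _)) ⊗ₖ
    ((π.kernel (n + 1)).comap (toHist n) (measurable_toHist n))

instance (π : Strategy X A) (n : ℕ) : IsMarkovKernel (M.transition π n) := by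
  unfold transition; infer_instance

/-- The law of `(x_0, b_1)` when the initial state is `x`. -/
def initial (π : Strategy X A) (x : XΔ X) : Measure (XΔ X × Ctrl A) :=
  (π.kernel 0 (Fin.elim0, x)).map (Prod.mk x)

/-- The strategic measure `P_x^π` on trajectories `ω`, where `ω n = (X_n, B_{n+1})`, given by the
Ionescu-Tulcea theorem. -/
def P (π : Strategy X A) (x : XΔ X) : Measure (ℕ → XΔ X × Ctrl A) :=
  Kernel.trajMeasure (X := fun _ => XΔ X × Ctrl A) (initial π x) (M.transition π)

/-- The performance `𝒱_j(x, π)`. -/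
def performance (j : Fin (J + 1)) (π : Strategy X A) (x : XΔ X) : ℝ≥0∞ :=
  ∫⁻ ω, ∑' n, M.stepCost j (ω n) ∂(M.P π x)

/-- The expected total cost `E_x^π [∑_n ∑_j C̄_j(X_n, B_{n+1})]`. -/
def totalCost (π : Strategy X A) (x : XΔ X) : ℝ≥0∞ :=
  ∫⁻ ω, ∑' n, ∑ j, M.cost j (ω n) ∂(M.P π x)

/-- The occupation measure `μ^π` for the initial state `x`:
`μ^π(S) = E_x^π [∑_n 𝕀{(X_n, B_{n+1}) ∈ S}]`. -/
def occupation (π : Strategy X A) (x : XΔ X) : Measure (XΔ X × Ctrl A) :=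
  Measure.sum fun n => (M.P π x).map fun ω => ω n

theorem occupation_apply (π : Strategy X A) (x : XΔ X) {S : Set (XΔ X × Ctrl A)}
    (hS : MeasurableSet S) :
    M.occupation π x S = ∫⁻ ω, ∑' n, S.indicator 1 (ω n) ∂(M.P π x) := by
  have h : ∀ n, Measurable fun ω : ℕ → XΔ X × Ctrl A => ω n := fun n => measurable_pi_apply n
  have h1 : Measurable (S.indicator (1 : XΔ X × Ctrl A → ℝ≥0∞)) := measurable_one.indicator hS
  have h2 : ∀ n, AEMeasurable (fun ω : ℕ → XΔ X × Ctrl A => 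
      S.indicator (1 : XΔ X × Ctrl A → ℝ≥0∞) (ω n))
      (M.P π x) := fun n => (h1.comp (h n)).aemeasurable
  rw [lintegral_tsum h2, occupation, Measure.sum_apply _ hS]
  congr 1 with n
  rw [← lintegral_map h1 (h n), lintegral_indicator_one hS]

/-- The strategy `π` is feasible for the constrained problem started from `x₀`. -/
def StrategyFeasible (d : Fin J → ℝ≥0) (x₀ : X) (π : Strategy X A) : Prop :=
  ∀ j : Fin J, M.performance j.succ π (Sum.inl x₀) ≤ d j

/-- There is a feasible strategy with finite value. -/
def Consistent (d : Fin J → ℝ≥0) (x₀ : X) : Prop :=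
  ∃ π : Strategy X A, M.StrategyFeasible d x₀ π ∧ M.performance 0 π (Sum.inl x₀) < ∞

/-- The measure `μ` is feasible in the linear program. -/
structure LPFeasible (d : Fin J → ℝ≥0) (x₀ : X) (μ : Measure (XΔ X × Ctrl A)) : Prop where
  balance : μ.map Prod.fst = Measure.dirac (Sum.inl x₀) + μ.bind M.Q
  constraint : ∀ j : Fin J, ∫⁻ p, M.cost j.succ p ∂μ ≤ d j

/-- The measure `μ` has a finite value in the linear program. -/
def FiniteValue (μ : Measure (XΔ X × Ctrl A)) : Prop := ∫⁻ p, M.cost 0 p ∂μ < ∞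

/-- The set `V` of states from which the optimal total cost is positive. -/
def V : Set (XΔ X) := {x | 0 < ⨅ π : Strategy X A, M.totalCost π x}

/-- The map `f` is a deterministic stationary strategy that attains the optimal total cost from
every state and never moves from `Vᶜ` into `V`. -/
structure IsOptimalSelector (f : XΔ X → Ctrl A) : Prop where
  measurable : Measurable f
  optimal : ∀ x, ⨅ π : Strategy X A, M.totalCost π x =
    M.totalCost (Strategy.deterministic f measurable) x
  stays : ∀ x ∈ M.Vᶜ, M.Q (x, f x) M.V = 0

end Model

/-- `φ(db|x) μ(dx × B) = μ(dx × db)` on the Borel subsets of `W × B`. -/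
def Disintegrates (W : Set (XΔ X)) (φ : Kernel W (Ctrl A)) (μ : Measure (XΔ X × Ctrl A)) : Prop :=
  ∀ S : Set (W × Ctrl A), MeasurableSet S →
    ∫⁻ x : W, φ x {b | (x, b) ∈ S} ∂((μ.map Prod.fst).comap Subtype.val) =
      μ ((fun p : W × Ctrl A => ((p.1 : XΔ X), p.2)) '' S)

open Classical in
/-- The stochastic kernel equal to `φ(·|x)` for `x ∈ W` and to `δ_{f(x)}` for `x ∉ W`. -/
def glue {W : Set (XΔ X)} (hW : MeasurableSet W) (φ : Kernel W (Ctrl A)) (f : XΔ X → Ctrl A)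
    (hf : Measurable f) : Kernel (XΔ X) (Ctrl A) where
  toFun x := if h : x ∈ W then φ ⟨x, h⟩ else Measure.dirac (f x)
  measurable' := Measurable.dite (s := W) (f := fun x => φ x)
    (g := fun x : (Wᶜ : Set (XΔ X)) => Measure.dirac (f x)) φ.measurable
    (Measure.measurable_dirac.comp (hf.comp measurable_subtype_coe)) hW

open Classical in
instance {W : Set (XΔ X)} (hW : MeasurableSet W) (φ : Kernel W (Ctrl A)) [IsMarkovKernel φ]
    (f : XΔ X → Ctrl A) (hf : Measurable f) : IsMarkovKernel (glue hW φ f hf) where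
  isProbabilityMeasure x := by
    change IsProbabilityMeasure (if h : x ∈ W then φ ⟨x, h⟩ else Measure.dirac (f x))
    split_ifs <;> infer_instance

end

end ImpulseControl

end

/-! Let `valueIter n` be the finite-horizon values of the summed cost. They increase with `n` and
bound the cost of every strategy from below. Compactness and lower semicontinuity give the converse:
if all of them vanish at a state, some control costs nothing and leads to a state of the same kind,
and iterating this costs zero in total. Hence `V` is the union of the sets `{valueIter n > 0}`
(`mem_V_iff`), and is Borel.

Although `μ` may be infinite, it is finite over `{ε ≤ valueIter n}` for `ε > 0`: by induction on
`n`, a large value forces either a large immediate cost, controlled by Markov's inequality, or a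
large value at the next state, controlled by the balance equation (`measure_valueIter_lt_top`). This
gives σ-finiteness over `V`, hence the kernel.

Domination is an induction on the number of steps (`sum_stateLaw_le`): the glued strategy never
enters `V` from outside, so each visit to `V` comes from the initial state or from `V`, where the
kernel reproduces `μ`; the balance equation closes the induction. -/

noncomputable section

namespace ImpulseControl

universe u v

/-! ### One-step integral formulas for strategic measures -/

section Trajectories

variable {X : Type u} {A : Type v} [MeasurableSpace X] [MeasurableSpace A] {J : ℕ}

namespace Model

variable (M : Model X A J)

instance isProbabilityMeasure_initial (π : Strategy X A) (x : XΔ X) :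
    IsProbabilityMeasure (initial π x) :=
  Measure.isProbabilityMeasure_map (by fun_prop)

instance isProbabilityMeasure_P (π : Strategy X A) (x : XΔ X) : IsProbabilityMeasure (M.P π x) := by
  unfold P; infer_instance

theorem map_zero_P (π : Strategy X A) (x : XΔ X) :
    (M.P π x).map (fun ω => ω 0) = initial π x := by
  have h : (fun ω : ℕ → XΔ X × Ctrl A => ω 0) =
      (fun z : (i : Finset.Iic 0) → XΔ X × Ctrl A => z ⟨0, by simp⟩) ∘
        Preorder.frestrictLe (π := fun _ => XΔ X × Ctrl A) 0 := rfl
  rw [h, ← Measure.map_map (by fun_prop) (by fun_prop), P, Kernel.trajMeasure,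
    Measure.map_comp _ _ (by fun_prop), Kernel.traj_map_frestrictLe, Kernel.partialTraj_self,
    Measure.id_comp, Measure.map_map (by fun_prop) (by fun_prop)]
  convert! Measure.map_id

theorem lintegral_zero_P (π : Strategy X A) (x : XΔ X) {g : XΔ X × Ctrl A → ℝ≥0∞}
    (hg : Measurable g) :
    ∫⁻ ω, g (ω 0) ∂(M.P π x) = ∫⁻ b, g (x, b) ∂(π.kernel 0 (Fin.elim0, x)) := by
  rw [← lintegral_map (f := g) hg (measurable_pi_apply 0), map_zero_P, initial,
    lintegral_map hg (by fun_prop)]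

/-- The law of the trajectory up to `n` is composed with `transition`; as `Q` is a Dirac kernel,
only the integral over the next control remains. -/
theorem lintegral_succ_P (π : Strategy X A) (x : XΔ X) (n : ℕ) {g : XΔ X × Ctrl A → ℝ≥0∞}
    (hg : Measurable g) :
    ∫⁻ ω, g (ω (n + 1)) ∂(M.P π x) =
      ∫⁻ ω, ∫⁻ b, g (M.next (ω n), b) ∂(π.kernel (n + 1)
        (toHist n (Preorder.frestrictLe (π := fun _ => XΔ X × Ctrl A) n ω, M.next (ω n))))
        ∂(M.P π x) := by
  have h := Kernel.map_frestrictLe_trajMeasure_compProd_eq_map_trajMeasure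
    (X := fun _ => XΔ X × Ctrl A) (μ₀ := initial π x) (κ := M.transition π) (a := n)
  have h1 := congrArg (fun ρ => ∫⁻ p, g p.2 ∂ρ) h
  beta_reduce at h1
  have hg2 : Measurable fun p : (Finset.Iic n → XΔ X × Ctrl A) × (XΔ X × Ctrl A) => g p.2 :=
    hg.comp measurable_snd
  rw [lintegral_map hg2 (by fun_prop), Measure.lintegral_compProd hg2,
    lintegral_map hg2.lintegral_kernel_prod_right' (by fun_prop)] at h1
  refine h1.symm.trans (lintegral_congr fun ω => ?_)
  rw [transition, Kernel.lintegral_compProd _ _ _ hg, Kernel.comap_apply, Q,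
    Kernel.deterministic_apply, lintegral_dirac']
  · rfl
  · exact hg.lintegral_kernel_prod_right''

theorem lintegral_fst_zero_P (π : Strategy X A) (x : XΔ X) {g : XΔ X → ℝ≥0∞} (hg : Measurable g) :
    ∫⁻ ω, g (ω 0).1 ∂(M.P π x) = g x := by
  rw [M.lintegral_zero_P π x (g := fun p => g p.1) (hg.comp measurable_fst)]
  simp

theorem lintegral_fst_succ_P (π : Strategy X A) (x : XΔ X) (n : ℕ) {g : XΔ X → ℝ≥0∞}
    (hg : Measurable g) :
    ∫⁻ ω, g (ω (n + 1)).1 ∂(M.P π x) = ∫⁻ ω, g (M.next (ω n)) ∂(M.P π x) := by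
  rw [M.lintegral_succ_P π x n (g := fun p => g p.1) (hg.comp measurable_fst)]
  simp

/-- Under a stationary strategy, the control is drawn from the kernel given the current state. -/
theorem lintegral_stationary_P (κ : Kernel (XΔ X) (Ctrl A)) [IsMarkovKernel κ] (x : XΔ X) (n : ℕ)
    {g : XΔ X × Ctrl A → ℝ≥0∞} (hg : Measurable g) :
    ∫⁻ ω, g (ω n) ∂(M.P (Strategy.stationary κ) x) =
      ∫⁻ ω, ∫⁻ b, g ((ω n).1, b) ∂(κ (ω n).1) ∂(M.P (Strategy.stationary κ) x) := by
  have hg' : Measurable fun y => ∫⁻ b, g (y, b) ∂(κ y) := hg.lintegral_kernel_prod_right'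
  cases n with
  | zero =>
    rw [M.lintegral_zero_P _ x hg, M.lintegral_fst_zero_P _ x hg']
    rfl
  | succ n =>
    rw [M.lintegral_succ_P _ x n hg, M.lintegral_fst_succ_P _ x n hg']
    rfl

/-- The strategy that applies a fixed sequence of controls. -/
def openLoop (b : ℕ → Ctrl A) : Strategy X A where
  kernel n := Kernel.const _ (Measure.dirac (b n))
  markov _ := inferInstance

/-- Since the dynamics are deterministic, a zero-cost path from one given state can be realised by a
fixed control sequence, with no measurable selection. -/
theorem lintegral_openLoop_P (b : ℕ → Ctrl A) (y : ℕ → XΔ X)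
    (hy : ∀ n, y (n + 1) = M.next (y n, b n)) (n : ℕ) {g : XΔ X × Ctrl A → ℝ≥0∞}
    (hg : Measurable g) :
    ∫⁻ ω, g (ω n) ∂(M.P (openLoop b) (y 0)) = g (y n, b n) := by
  induction n generalizing g with
  | zero =>
    rw [M.lintegral_zero_P _ _ hg]
    exact lintegral_dirac' _ (hg.comp measurable_prodMk_left)
  | succ n ih =>
    rw [M.lintegral_succ_P _ _ n hg, hy, ← ih (g := fun p => g (M.next p, b (n + 1)))
      (hg.comp (M.measurable_next.prodMk measurable_const))]
    exact lintegral_congr fun ω => lintegral_dirac' _ (hg.comp measurable_prodMk_left)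

end Model

end Trajectories

/-! ### Lower semicontinuity of infima, integrals and truncations -/

section Semicontinuity

theorem lowerSemicontinuous_iInf_of_compactSpace {Y B : Type*} [TopologicalSpace Y]
    [TopologicalSpace B] [CompactSpace B] {f : Y × B → ℝ≥0∞} (hf : LowerSemicontinuous f) :
    LowerSemicontinuous fun y => ⨅ b, f (y, b) := by
  intro y₀ t ht
  -- A level strictly between is needed: `t' < f (y, b)` for all `b` only yields `t' ≤` the infimum.
  obtain ⟨t', htt', ht'⟩ := exists_between ht
  have h := isCompact_univ.eventually_forall_of_forall_eventually (x₀ := y₀) (K := (univ : Set B))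
    (P := fun y b => t' < f (y, b))
    fun b _ => hf (y₀, b) t' (ht'.trans_le (iInf_le _ b))
  filter_upwards [h] with y hy
  exact htt'.trans_le (le_iInf fun b => (hy b (mem_univ b)).le)

/-- Fatou's lemma along the neighbourhood filter, which first countability makes countably
generated. -/
theorem lowerSemicontinuous_lintegral {Y T : Type*} [TopologicalSpace Y] [FirstCountableTopology Y]
    [MeasurableSpace T] {ρ : Measure T} {F : Y → T → ℝ≥0∞} (hm : ∀ y, Measurable (F y))
    (hF : ∀ t, LowerSemicontinuous fun y => F y t) :
    LowerSemicontinuous fun y => ∫⁻ t, F y t ∂ρ := by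
  rw [lowerSemicontinuous_iff_le_liminf]
  intro y
  calc ∫⁻ t, F y t ∂ρ ≤ ∫⁻ t, Filter.liminf (fun z => F z t) (𝓝 y) ∂ρ :=
        lintegral_mono fun t => lowerSemicontinuous_iff_le_liminf.1 (hF t) y
    _ ≤ _ := lintegral_liminf_le hm

theorem lowerSemicontinuous_coe_nnreal {Y : Type*} [TopologicalSpace Y] {f : Y → ℝ≥0}
    (hf : LowerSemicontinuous f) : LowerSemicontinuous fun y => (f y : ℝ≥0∞) :=
  ENNReal.continuous_coe.comp_lowerSemicontinuous hf ENNReal.coe_mono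

/-- A nonnegative lower semicontinuous function of a finite time remains so after extension by
zero to infinite times. -/
theorem lowerSemicontinuous_ite_lt_top {Y A : Type*} [TopologicalSpace Y] [TopologicalSpace A]
    {g : Y × ℝ≥0 × A → ℝ≥0∞} (hg : LowerSemicontinuous g) :
    LowerSemicontinuous fun p : Y × ℝ≥0∞ × A =>
      if p.2.1 < ∞ then g (p.1, p.2.1.toNNReal, p.2.2) else 0 := by
  rintro ⟨y, θ, a⟩ t ht
  by_cases hθ : θ < ∞
  · simp only [hθ, if_true] at ht
    have hc : ContinuousAt (fun p : Y × ℝ≥0∞ × A => (p.1, p.2.1.toNNReal, p.2.2)) (y, θ, a) := by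
      refine continuousAt_fst.prodMk (ContinuousAt.prodMk ?_ (by fun_prop))
      exact ContinuousAt.comp (g := ENNReal.toNNReal)
        (ENNReal.tendsto_toNNReal hθ.ne) (f := fun p : Y × ℝ≥0∞ × A => p.2.1)
        (x := (y, θ, a)) (by fun_prop)
    have h1 : ∀ᶠ p : Y × ℝ≥0∞ × A in 𝓝 (y, θ, a), p.2.1 < ∞ :=
      (isOpen_Iio.preimage (by fun_prop : Continuous fun p : Y × ℝ≥0∞ × A => p.2.1)).mem_nhds hθ
    filter_upwards [h1, hc.eventually (hg _ t ht)] with p hp hp'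
    simpa only [hp, if_true] using hp'
  · simp [hθ] at ht

end Semicontinuity

/-! ### Borel spaces as standard Borel spaces -/

theorem standardBorelSpace_of_measurableEquiv {α β : Type*} [MeasurableSpace α]
    [MeasurableSpace β] [StandardBorelSpace β] (f : α ≃ᵐ β) : StandardBorelSpace α := by
  obtain ⟨τ, _, _⟩ := StandardBorelSpace.polish (α := β)
  let : TopologicalSpace α := TopologicalSpace.induced f inferInstance
  have : BorelSpace α := ⟨f.measurableEmbedding.comap_eq.symm.trans
      ((congrArg (MeasurableSpace.comap (f : α → β)) BorelSpace.measurable_eq).trans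
        borel_comap.symm)⟩
  have : PolishSpace α := f.toEquiv.polishSpace_induced
  infer_instance

theorem IsBorelSpace.standardBorelSpace {A : Type v} [TopologicalSpace A] [MeasurableSpace A]
    [BorelSpace A] (hA : IsBorelSpace A) : StandardBorelSpace A := by
  obtain ⟨P, _, _, e, he, hr⟩ := hA
  let : MeasurableSpace P := borel P
  have : BorelSpace P := ⟨rfl⟩
  have : StandardBorelSpace (range e) := hr.standardBorel
  exact standardBorelSpace_of_measurableEquiv (he.measurableEmbedding hr).equivRange

theorem IsBorelSpace.secondCountableTopology {X : Type u} [TopologicalSpace X]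
    (hX : IsBorelSpace X) : SecondCountableTopology X := by
  obtain ⟨P, _, _, e, he, -⟩ := hX
  exact he.secondCountableTopology

/-! ### Value iteration and the characterisation of `V` -/

section ValueIteration

variable {X : Type u} {A : Type v} [MeasurableSpace X] [MeasurableSpace A] {J : ℕ}

namespace Model

variable (M : Model X A J)

/-- The sum of all the costs of one step. -/
def sumCost (p : XΔ X × Ctrl A) : ℝ≥0∞ := ∑ j, M.cost j p

@[simp] theorem sumCost_inr (b : Ctrl A) : M.sumCost (Sum.inr (), b) = 0 :=
  Finset.sum_eq_zero fun _ _ => rfl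

/-- The value functions of the problems with finite horizons for the sum of the costs. -/
def valueIter : ℕ → XΔ X → ℝ≥0∞
  | 0 => fun _ => 0
  | n + 1 => fun x => ⨅ b : Ctrl A, (M.sumCost (x, b) + valueIter n (M.next (x, b)))

theorem valueIter_succ (n : ℕ) (x : XΔ X) :
    M.valueIter (n + 1) x = ⨅ b : Ctrl A, (M.sumCost (x, b) + M.valueIter n (M.next (x, b))) := rfl

theorem monotone_valueIter : Monotone M.valueIter := by
  refine monotone_nat_of_le_succ fun n => ?_
  induction n with
  | zero => exact fun x => zero_le
  | succ n ih => exact fun x => iInf_mono fun b => by gcongr; exact ih _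

theorem valueIter_inr [Nonempty A] (n : ℕ) : M.valueIter n (Sum.inr ()) = 0 := by
  induction n with
  | zero => rfl
  | succ n ih =>
    rw [valueIter_succ]
    simp only [sumCost_inr, zero_add]
    have h : ∀ b : Ctrl A, M.next (Sum.inr (), b) = Sum.inr () := fun _ => rfl
    simp [h, ih]

/-- Dropping the endpoint `θ` makes the integrand lower semicontinuous in `θ`, because `{θ | t < θ}`
is open. -/
theorem cost_inl (j : Fin (J + 1)) (x : X) (b : Ctrl A) :
    M.cost j (Sum.inl x, b) =
      (∫⁻ t, {t : ℝ | 0 ≤ t ∧ ENNReal.ofReal t < b.1}.indicator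
        (fun t => (M.Cg j (M.flow x t.toNNReal) : ℝ≥0∞)) t) +
      if b.1 < ∞ then (M.CI j (M.flow x b.1.toNNReal) b.2 : ℝ≥0∞) else 0 := by
  have hs : MeasurableSet {t : ℝ | 0 ≤ t ∧ ENNReal.ofReal t < b.1} :=
    measurableSet_Ici.inter (ENNReal.measurable_ofReal measurableSet_Iio)
  rw [lintegral_indicator hs]
  change _ + _ = _
  congr 1
  refine setLIntegral_congr ?_
  -- For `θ = ∞` the excluded point is `0`, since `∞.toReal = 0`; this is harmless, as it is still a
  -- null set.
  have h0 : (volume : Measure ℝ) {b.1.toReal} = 0 := Real.volume_singleton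
  filter_upwards [compl_mem_ae_iff.2 h0] with t ht
  have ht' : t ≠ b.1.toReal := ht
  refine propext ⟨fun h => ⟨h.1, lt_of_le_of_ne h.2 fun he => ht' ?_⟩, fun h => ⟨h.1, h.2.le⟩⟩
  rw [← he, ENNReal.toReal_ofReal h.1]

variable {M}

theorem totalCost_eq_tsum (hc : Measurable M.sumCost) (π : Strategy X A) (x : XΔ X) :
    M.totalCost π x = ∑' n, ∫⁻ ω, M.sumCost (ω n) ∂(M.P π x) :=
  lintegral_tsum fun n => (hc.comp (measurable_pi_apply n)).aemeasurable

theorem valueIter_le_totalCost (hc : Measurable M.sumCost) (hv : ∀ n, Measurable (M.valueIter n))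
    (π : Strategy X A) (x : XΔ X) (n : ℕ) : M.valueIter n x ≤ M.totalCost π x := by
  -- Starting at an arbitrary time `k` lets the induction stay under the single measure `M.P π x`,
  -- without shifted strategies.
  have h : ∀ m k, ∫⁻ ω, M.valueIter m (ω k).1 ∂(M.P π x) ≤
      ∑ i ∈ Finset.range m, ∫⁻ ω, M.sumCost (ω (k + i)) ∂(M.P π x) := by
    intro m
    induction m with
    | zero => intro k; simp [valueIter]
    | succ m ih =>
      intro k
      calc ∫⁻ ω, M.valueIter (m + 1) (ω k).1 ∂(M.P π x)
          ≤ ∫⁻ ω, (M.sumCost (ω k) + M.valueIter m (M.next (ω k))) ∂(M.P π x) :=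
            lintegral_mono fun ω => iInf_le _ (ω k).2
        _ = ∫⁻ ω, M.sumCost (ω k) ∂(M.P π x) + ∫⁻ ω, M.valueIter m (ω (k + 1)).1 ∂(M.P π x) := by
            rw [lintegral_add_left (f := fun ω : ℕ → XΔ X × Ctrl A => M.sumCost (ω k))
              (hc.comp (measurable_pi_apply k)),
              M.lintegral_fst_succ_P π x k (hv m)]
        _ ≤ _ := by
            rw [Finset.sum_range_succ', add_comm]
            simp only [add_zero]
            gcongr
            refine (ih (k + 1)).trans_eq (Finset.sum_congr rfl fun i _ => ?_)
            rw [add_right_comm, add_assoc]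
  rw [totalCost_eq_tsum hc, ← M.lintegral_fst_zero_P π x (hv n)]
  refine (h n 0).trans ?_
  simp only [zero_add]
  exact ENNReal.sum_le_tsum _

section Topological

variable [TopologicalSpace X] [TopologicalSpace A]

theorem CompactContinuous.lowerSemicontinuous_cost [FirstCountableTopology X]
    [FirstCountableTopology A] (hM : M.CompactContinuous) (j : Fin (J + 1)) :
    LowerSemicontinuous fun p : X × Ctrl A => M.cost j (Sum.inl p.1, p.2) := by
  simp only [cost_inl]
  refine LowerSemicontinuous.add ?_ ?_
  · refine lowerSemicontinuous_lintegral (fun p => ?_) fun t => ?_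
    · refine Measurable.indicator ?_
        (measurableSet_Ici.inter (ENNReal.measurable_ofReal measurableSet_Iio))
      exact ((M.measurable_Cg j).comp (M.measurable_flow.comp
        (measurable_const.prodMk measurable_real_toNNReal))).coe_nnreal_ennreal
    · rintro ⟨x, b⟩ s hs
      by_cases hb : 0 ≤ t ∧ ENNReal.ofReal t < b.1
      · have h1 : ∀ᶠ p : X × Ctrl A in 𝓝 (x, b), ENNReal.ofReal t < p.2.1 :=
          (isOpen_Ioi.preimage (by fun_prop : Continuous fun p : X × Ctrl A => p.2.1)).mem_nhds hb.2
        have h2 : LowerSemicontinuous fun p : X × Ctrl A =>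
            (M.Cg j (M.flow p.1 t.toNNReal) : ℝ≥0∞) :=
          lowerSemicontinuous_coe_nnreal ((hM.lsc_Cg j).comp
            (hM.continuous_flow.comp (continuous_fst.prodMk continuous_const)))
        have hs' : s < (M.Cg j (M.flow x t.toNNReal) : ℝ≥0∞) := by
          simpa [indicator, hb] using hs
        filter_upwards [h1, h2 (x, b) s hs'] with p hp hp'
        simpa [indicator, hb.1, hp] using hp'
      · simp [indicator, hb] at hs
  · refine lowerSemicontinuous_ite_lt_top (Y := X) (A := A)
      (g := fun q => (M.CI j (M.flow q.1 q.2.1) q.2.2 : ℝ≥0∞)) ?_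
    refine lowerSemicontinuous_coe_nnreal ((hM.lsc_CI j).comp
      (g := fun q : X × ℝ≥0 × A => (M.flow q.1 q.2.1, q.2.2)) ?_)
    exact (hM.continuous_flow.comp (continuous_fst.prodMk continuous_snd.fst)).prodMk
      continuous_snd.snd

theorem CompactContinuous.lowerSemicontinuous_sumCost [FirstCountableTopology X]
    [FirstCountableTopology A] (hM : M.CompactContinuous) :
    LowerSemicontinuous fun p : X × Ctrl A => M.sumCost (Sum.inl p.1, p.2) :=
  lowerSemicontinuous_sum fun j _ => hM.lowerSemicontinuous_cost j

/-- The jump to `Δ` at `θ = ∞` breaks continuity of `next`, but there `v` takes its least value `0`,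
so lower semicontinuity survives. -/
theorem CompactContinuous.lowerSemicontinuous_comp_next (hM : M.CompactContinuous)
    {v : XΔ X → ℝ≥0∞} (hv : LowerSemicontinuous fun x => v (Sum.inl x)) (h0 : v (Sum.inr ()) = 0) :
    LowerSemicontinuous fun p : X × Ctrl A => v (M.next (Sum.inl p.1, p.2)) := by
  have h : (fun p : X × Ctrl A => v (M.next (Sum.inl p.1, p.2))) = fun p : X × Ctrl A =>
      if p.2.1 < ∞ then v (Sum.inl (M.impulse (M.flow p.1 p.2.1.toNNReal) p.2.2)) else 0 := by
    funext p
    by_cases hp : p.2.1 = ∞ <;> simp [next, hp, h0, lt_top_iff_ne_top]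
  rw [h]
  refine lowerSemicontinuous_ite_lt_top (Y := X) (A := A)
    (g := fun q => v (Sum.inl (M.impulse (M.flow q.1 q.2.1) q.2.2))) (hv.comp
      (g := fun q : X × ℝ≥0 × A => M.impulse (M.flow q.1 q.2.1) q.2.2) ?_)
  exact hM.continuous_impulse.comp ((hM.continuous_flow.comp
    (continuous_fst.prodMk continuous_snd.fst)).prodMk continuous_snd.snd)

theorem CompactContinuous.lowerSemicontinuous_valueIter [FirstCountableTopology X]
    [FirstCountableTopology A] [Nonempty A] (hM : M.CompactContinuous) (n : ℕ) :
    LowerSemicontinuous fun x => M.valueIter n (Sum.inl x) := by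
  have := hM.compact
  induction n with
  | zero => exact lowerSemicontinuous_const
  | succ n ih =>
    exact lowerSemicontinuous_iInf_of_compactSpace
      (f := fun p : X × Ctrl A => M.sumCost (Sum.inl p.1, p.2) +
        M.valueIter n (M.next (Sum.inl p.1, p.2)))
      (hM.lowerSemicontinuous_sumCost.add
        (hM.lowerSemicontinuous_comp_next ih (M.valueIter_inr n)))

theorem CompactContinuous.measurable_valueIter [BorelSpace X] [FirstCountableTopology X]
    [FirstCountableTopology A] [Nonempty A] (hM : M.CompactContinuous) (n : ℕ) :
    Measurable (M.valueIter n) :=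
  measurable_fun_sum (hM.lowerSemicontinuous_valueIter n).measurable (measurable_of_countable _)

theorem CompactContinuous.measurable_cost [BorelSpace X] [BorelSpace A]
    [SecondCountableTopology X] [SecondCountableTopology A] (hM : M.CompactContinuous)
    (j : Fin (J + 1)) : Measurable (M.cost j) := by
  have h : Measurable (M.cost j ∘ (MeasurableEquiv.sumProdDistrib X Unit (Ctrl A)).symm) :=
    measurable_fun_sum (hM.lowerSemicontinuous_cost j).measurable measurable_const
  simpa [Function.comp_assoc] using
    h.comp (MeasurableEquiv.sumProdDistrib X Unit (Ctrl A)).measurable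

theorem CompactContinuous.measurable_sumCost [BorelSpace X] [BorelSpace A]
    [SecondCountableTopology X] [SecondCountableTopology A] (hM : M.CompactContinuous) :
    Measurable M.sumCost :=
  Finset.measurable_fun_sum _ fun j _ => hM.measurable_cost j

/-- If all the finite horizon values vanish, then some control costs nothing and leads to a state
with the same property. -/
theorem CompactContinuous.exists_sumCost_eq_zero [FirstCountableTopology X]
    [FirstCountableTopology A] [Nonempty A] (hM : M.CompactContinuous) {x : XΔ X}
    (hx : ∀ n, M.valueIter n x = 0) :
    ∃ b, M.sumCost (x, b) = 0 ∧ ∀ n, M.valueIter n (M.next (x, b)) = 0 := by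
  have := hM.compact
  obtain x | ⟨⟨⟩⟩ := x
  · let F : ℕ → Ctrl A → ℝ≥0∞ := fun n b =>
      M.sumCost (Sum.inl x, b) + M.valueIter n (M.next (Sum.inl x, b))
    have hF : ∀ n, LowerSemicontinuous (F n) := fun n =>
      (hM.lowerSemicontinuous_sumCost.add (hM.lowerSemicontinuous_comp_next
        (hM.lowerSemicontinuous_valueIter n) (M.valueIter_inr n))).comp
        (g := fun b : Ctrl A => (x, b)) (by fun_prop)
    have hcl : ∀ n, IsClosed (F n ⁻¹' Iic 0) := fun n =>
      lowerSemicontinuous_iff_isClosed_preimage.1 (hF n) 0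
    -- Cantor's intersection theorem: the zero sets of `F n` are closed in a compact space, decrease
    -- because `valueIter` increases, and are nonempty because the infimum `valueIter (n + 1) x = 0`
    -- is attained.
    obtain ⟨b, hb⟩ := IsCompact.nonempty_iInter_of_directed_nonempty_isCompact_isClosed
      (fun n => F n ⁻¹' Iic 0)
      (directed_of_isDirected_le fun m n hmn b (hb : F n b ≤ 0) =>
        show F m b ≤ 0 from
          (add_le_add_right (M.monotone_valueIter hmn _) _).trans hb)
      (fun n => by
        obtain ⟨b, -, hb⟩ := ((hF n).lowerSemicontinuousOn univ).exists_isMinOn univ_nonempty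
          isCompact_univ
        refine ⟨b, ?_⟩
        have h : F n b ≤ M.valueIter (n + 1) (Sum.inl x) := le_iInf fun b' => hb (mem_univ b')
        rwa [hx] at h)
      (fun n => (hcl n).isCompact) hcl
    have hb' : ∀ n, F n b = 0 := fun n => nonpos_iff_eq_zero.1 (mem_iInter.1 hb n)
    exact ⟨b, (add_eq_zero.1 (hb' 0)).1, fun n => (add_eq_zero.1 (hb' n)).2⟩
  · exact ⟨Classical.arbitrary _, M.sumCost_inr _, M.valueIter_inr⟩

theorem CompactContinuous.mem_V_iff [BorelSpace X] [BorelSpace A]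
    [SecondCountableTopology X] [SecondCountableTopology A] [Nonempty A]
    (hM : M.CompactContinuous) {x : XΔ X} : x ∈ M.V ↔ ∃ n, M.valueIter n x ≠ 0 := by
  constructor
  · contrapose!
    intro hx
    -- The choice `c` need not be measurable: it is evaluated only along the one path `y` from `x`.
    choose! c hc0 hc using fun (y : XΔ X) (hy : ∀ n, M.valueIter n y = 0) =>
      hM.exists_sumCost_eq_zero hy
    let y : ℕ → XΔ X := fun n => Nat.rec x (fun _ z => M.next (z, c z)) n
    have hy : ∀ n k, M.valueIter k (y n) = 0 := fun n => by
      induction n with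
      | zero => exact hx
      | succ n ih => exact hc _ ih
    have h0 : M.totalCost (openLoop fun n => c (y n)) x = 0 := by
      rw [totalCost_eq_tsum hM.measurable_sumCost, ENNReal.tsum_eq_zero]
      intro n
      exact (M.lintegral_openLoop_P (fun n => c (y n)) y (fun n => rfl) n
        hM.measurable_sumCost).trans (hc0 _ (hy n))
    change ¬ (0 < ⨅ π : Strategy X A, M.totalCost π x)
    rw [not_lt, ← h0]
    exact iInf_le _ _
  · rintro ⟨n, hn⟩
    exact (pos_iff_ne_zero.2 hn).trans_le (le_iInf fun π =>
      valueIter_le_totalCost hM.measurable_sumCost hM.measurable_valueIter π x n)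

end Topological

end Model

end ValueIteration

/-! ### Disintegration of measures with σ-finite marginal -/

/-- A measure with σ-finite first marginal on a product with a standard Borel space is the
composition product of this marginal and a Markov kernel. -/
theorem exists_isMarkovKernel_compProd_eq {α Ω : Type*} [MeasurableSpace α] [MeasurableSpace Ω]
    [StandardBorelSpace Ω] [Nonempty Ω] (ρ : Measure (α × Ω)) [SigmaFinite ρ.fst] :
    ∃ κ : Kernel α Ω, IsMarkovKernel κ ∧ ρ.fst ⊗ₘ κ = ρ := by
  -- A positive integrable weight makes the measure finite; depending on the first coordinate only,
  -- it does not affect the conditional kernel.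
  obtain ⟨w, hw0, hw, hw1⟩ := exists_pos_lintegral_lt_of_sigmaFinite ρ.fst one_ne_zero
  have hw' : Measurable fun x => (w x : ℝ≥0∞) := hw.coe_nnreal_ennreal
  have hwf : Measurable fun p : α × Ω => (w p.1 : ℝ≥0∞) := hw'.comp measurable_fst
  have hwi : Measurable fun p : α × Ω => (w p.1 : ℝ≥0∞)⁻¹ := hwf.inv
  let ρ' := ρ.withDensity fun p => w p.1
  have : IsFiniteMeasure ρ' := isFiniteMeasure_withDensity (by
    rw [Measure.fst, lintegral_map hw' measurable_fst] at hw1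
    exact (hw1.trans ENNReal.one_lt_top).ne)
  have hfst : ρ'.fst = ρ.fst.withDensity fun x => w x := by
    ext s hs
    rw [Measure.fst_apply hs, withDensity_apply _ (measurable_fst hs), withDensity_apply _ hs,
      Measure.fst, setLIntegral_map hs hw' measurable_fst]
  have hmul : ∀ (x : α) (c : ℝ≥0∞), (w x : ℝ≥0∞) * ((w x : ℝ≥0∞)⁻¹ * c) = c := fun x c =>
    ENNReal.mul_inv_cancel_left (by exact_mod_cast (hw0 x).ne') ENNReal.coe_ne_top
  refine ⟨ρ'.condKernel, inferInstance, ?_⟩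
  ext S hS
  have hi : Measurable (S.indicator (1 : α × Ω → ℝ≥0∞)) := measurable_one.indicator hS
  have hwS : Measurable fun p : α × Ω => (w p.1 : ℝ≥0∞)⁻¹ * S.indicator 1 p := hwi.mul hi
  -- Testing the disintegration of `ρ'` against `w⁻¹ * 1_S` removes the weight.
  have h := congrArg (fun m => ∫⁻ p, (w p.1 : ℝ≥0∞)⁻¹ * S.indicator 1 p ∂m)
    (ρ'.disintegrate ρ'.condKernel)
  beta_reduce at h
  rw [Measure.lintegral_compProd hwS, hfst, lintegral_withDensity_eq_lintegral_mul _ hw'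
      hwS.lintegral_kernel_prod_right',
    lintegral_withDensity_eq_lintegral_mul _ hwf hwS] at h
  rw [← lintegral_indicator_one hS, Measure.lintegral_compProd hi, ← lintegral_indicator_one hS]
  refine Eq.trans ?_ (h.trans (lintegral_congr fun p => hmul p.1 _))
  refine lintegral_congr fun x => ?_
  simp only [Pi.mul_apply]
  rw [lintegral_const_mul (f := fun b => S.indicator 1 (x, b)) _
    (hi.comp measurable_prodMk_left), hmul]

/-! ### Feasible measures over `V` and domination of occupation measures -/

section LinearProgram

variable {X : Type u} {A : Type v} [MeasurableSpace X] [MeasurableSpace A] {J : ℕ}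
  {M : Model X A J} {d : Fin J → ℝ≥0} {x₀ : X} {μ : Measure (XΔ X × Ctrl A)}

theorem measurableEmbedding_subtype_prod {W : Set (XΔ X)} (hW : MeasurableSet W) :
    MeasurableEmbedding fun p : W × Ctrl A => ((p.1 : XΔ X), p.2) :=
  (MeasurableEmbedding.subtype_coe hW).prodMap .id

theorem exists_disintegrates [StandardBorelSpace A] [Nonempty A] {W : Set (XΔ X)}
    (hW : MeasurableSet W) [SigmaFinite ((μ.map Prod.fst).comap (Subtype.val : W → XΔ X))] :
    ∃ φ : Kernel W (Ctrl A), IsMarkovKernel φ ∧ Disintegrates W φ μ := by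
  let ρ := μ.comap fun p : W × Ctrl A => ((p.1 : XΔ X), p.2)
  have hfst : ρ.fst = (μ.map Prod.fst).comap (Subtype.val : W → XΔ X) := by
    ext s hs
    rw [Measure.fst_apply hs, (measurableEmbedding_subtype_prod hW).comap_apply,
      (MeasurableEmbedding.subtype_coe hW).comap_apply,
      Measure.map_apply measurable_fst ((MeasurableEmbedding.subtype_coe hW).measurableSet_image' hs)]
    congr 1
    ext ⟨x, b⟩
    simp
  have : SigmaFinite ρ.fst := by rw [hfst]; infer_instance
  obtain ⟨φ, hφ, h⟩ := exists_isMarkovKernel_compProd_eq ρ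
  refine ⟨φ, hφ, fun S hS => ?_⟩
  rw [← (measurableEmbedding_subtype_prod hW).comap_apply, ← hfst]
  change _ = ρ S
  conv_rhs => rw [← h]
  rw [Measure.compProd_apply hS]
  rfl

namespace Model

/-- Without actions, an infimum over controls would be `∞`, even at `Δ`. -/
theorem Consistent.nonempty_action (h : M.Consistent d x₀) : Nonempty A := by
  obtain ⟨π, -⟩ := h
  exact (nonempty_of_isProbabilityMeasure (π.kernel 0 (Fin.elim0, Sum.inl x₀))).map Prod.snd

theorem LPFeasible.measure_prod_univ (h : M.LPFeasible d x₀ μ) {S : Set (XΔ X)}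
    (hS : MeasurableSet S) :
    μ (S ×ˢ univ) = Measure.dirac (Sum.inl x₀) S + μ (M.next ⁻¹' S) := by
  have h1 := congrArg (fun m => m S) h.balance
  beta_reduce at h1
  rw [Measure.map_apply measurable_fst hS, Measure.add_apply,
    Measure.bind_apply hS M.Q.measurable.aemeasurable] at h1
  rw [prod_univ, h1]
  congr 1
  simp only [Q, Kernel.deterministic_apply' _ _ hS]
  exact lintegral_indicator_one (M.measurable_next hS)

theorem LPFeasible.lintegral_sumCost_lt_top (h : M.LPFeasible d x₀ μ) (hfin : M.FiniteValue μ)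
    (hm : ∀ j, Measurable (M.cost j)) : ∫⁻ p, M.sumCost p ∂μ < ∞ := by
  simp only [sumCost]
  rw [lintegral_finsetSum _ fun j _ => hm j, Fin.sum_univ_succ]
  exact ENNReal.add_lt_top.2 ⟨hfin, ENNReal.sum_lt_top.2 fun j _ =>
    (h.constraint j).trans_lt ENNReal.coe_lt_top⟩

/-- If `ε ≤ valueIter (n + 1) x`, then under every control the cost or the next value is at least `ε
/ 2`. Markov's inequality bounds the first event; by balance, the second has measure at most that of
`{ε / 2 ≤ valueIter n}` times the control space. Halving is why `ε` varies in the induction. -/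
theorem LPFeasible.measure_valueIter_lt_top (h : M.LPFeasible d x₀ μ)
    (hc : Measurable M.sumCost) (hv : ∀ n, Measurable (M.valueIter n))
    (hfin : ∫⁻ p, M.sumCost p ∂μ < ∞) (n : ℕ) {ε : ℝ≥0∞} (hε : ε ≠ 0) :
    μ ({x | ε ≤ M.valueIter n x} ×ˢ univ) < ∞ := by
  induction n generalizing ε with
  | zero =>
    have h0 : {x | ε ≤ M.valueIter 0 x} = ∅ := by
      ext x
      simp [valueIter, hε]
    simp [h0]
  | succ n ih =>
    have hε2 : ε / 2 ≠ 0 := by simp [hε]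
    have hS : MeasurableSet {x | ε / 2 ≤ M.valueIter n x} := measurableSet_le measurable_const (hv n)
    have hsub : {x | ε ≤ M.valueIter (n + 1) x} ×ˢ univ ⊆
        {p | ε / 2 ≤ M.sumCost p} ∪ M.next ⁻¹' {x | ε / 2 ≤ M.valueIter n x} := by
      rintro ⟨x, b⟩ ⟨hx, -⟩
      have h1 : ε ≤ M.sumCost (x, b) + M.valueIter n (M.next (x, b)) :=
        le_trans hx (iInf_le _ b)
      by_contra hcon
      simp only [mem_union, mem_ofPred_eq, mem_preimage, not_or, not_le] at hcon
      exact absurd h1 (not_le.2 ((ENNReal.add_lt_add hcon.1 hcon.2).trans_eq (ENNReal.add_halves ε)))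
    refine (measure_mono hsub).trans_lt ((measure_union_le _ _).trans_lt
      (ENNReal.add_lt_top.2 ⟨?_, ?_⟩))
    · exact ENNReal.lt_top_of_mul_ne_top_right
        ((mul_meas_ge_le_lintegral hc (ε / 2)).trans_lt hfin).ne hε2
    · refine lt_of_le_of_lt ?_ (ih hε2)
      rw [h.measure_prod_univ hS]
      exact le_add_self

theorem iUnion_valueIter (hV : ∀ x, x ∈ M.V ↔ ∃ n, M.valueIter n x ≠ 0) :
    ⋃ q : ℕ × ℕ, {x | (q.2 + 1 : ℝ≥0∞)⁻¹ ≤ M.valueIter q.1 x} = M.V := by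
  ext x
  rw [hV, mem_iUnion]
  constructor
  · rintro ⟨⟨n, k⟩, h⟩
    refine ⟨n, (lt_of_lt_of_le (ENNReal.inv_pos.2 ?_) h).ne'⟩
    finiteness
  · rintro ⟨n, hn⟩
    obtain ⟨k, hk⟩ := ENNReal.exists_inv_nat_lt hn
    refine ⟨(n, k), le_trans (ENNReal.inv_le_inv.2 ?_) hk.le⟩
    simp

theorem LPFeasible.exists_spanning (h : M.LPFeasible d x₀ μ)
    (hc : Measurable M.sumCost) (hv : ∀ n, Measurable (M.valueIter n))
    (hfin : ∫⁻ p, M.sumCost p ∂μ < ∞) (hV : ∀ x, x ∈ M.V ↔ ∃ n, M.valueIter n x ≠ 0) :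
    ∃ S : ℕ × ℕ → Set (XΔ X), (∀ q, MeasurableSet (S q)) ∧ (∀ q, μ (S q ×ˢ univ) < ∞) ∧
      ⋃ q, S q = M.V :=
  ⟨fun q => {x | (q.2 + 1 : ℝ≥0∞)⁻¹ ≤ M.valueIter q.1 x},
    fun q => measurableSet_le measurable_const (hv q.1),
    fun q => h.measure_valueIter_lt_top hc hv hfin q.1 (ENNReal.inv_ne_zero.2 (by finiteness)),
    iUnion_valueIter hV⟩

theorem sigmaFinite_restrict_of_spanning {W : Set (XΔ X)} {S : ℕ × ℕ → Set (XΔ X)}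
    (hm : ∀ q, MeasurableSet (S q)) (hfin : ∀ q, μ (S q ×ˢ univ) < ∞) (hS : ⋃ q, S q = W) :
    SigmaFinite (μ.restrict (W ×ˢ univ)) := by
  have hW : MeasurableSet W := hS ▸ MeasurableSet.iUnion hm
  refine Measure.sigmaFinite_of_countable
    -- The complement is null for the restricted measure and completes the cover.
    (S := insert (W ×ˢ univ)ᶜ (range fun q => S q ×ˢ (univ : Set (Ctrl A))))
    ((countable_range _).insert _) ?_ ?_
  · rintro s (rfl | ⟨q, rfl⟩)
    · rw [Measure.restrict_apply (hW.prod .univ).compl]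
      simp
    · exact (Measure.restrict_apply_le _ _).trans_lt (hfin q)
  · rw [sUnion_insert, sUnion_range, ← iUnion_prod_const, hS, compl_union_self]

theorem sigmaFinite_comap_of_spanning {W : Set (XΔ X)} {S : ℕ × ℕ → Set (XΔ X)}
    (hm : ∀ q, MeasurableSet (S q)) (hfin : ∀ q, μ (S q ×ˢ univ) < ∞) (hS : ⋃ q, S q = W) :
    SigmaFinite ((μ.map Prod.fst).comap (Subtype.val : W → XΔ X)) := by
  have hW : MeasurableSet W := hS ▸ MeasurableSet.iUnion hm
  refine Measure.sigmaFinite_of_countable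
    (S := range fun q => (Subtype.val ⁻¹' S q : Set W)) (countable_range _) ?_ ?_
  · rintro s ⟨q, rfl⟩
    rw [(MeasurableEmbedding.subtype_coe hW).comap_apply]
    refine (measure_mono (image_preimage_subset _ _)).trans_lt ?_
    rw [Measure.map_apply measurable_fst (hm q), ← prod_univ]
    exact hfin q
  · rw [sUnion_range, ← preimage_iUnion, hS, Subtype.coe_preimage_self]

variable (M) in
/-- The law of the state `X_n` under a strategy. -/
def stateLaw (π : Strategy X A) (x : XΔ X) (n : ℕ) : Measure (XΔ X) :=
  (M.P π x).map fun ω => (ω n).1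

theorem stateLaw_zero (π : Strategy X A) (x : XΔ X) : M.stateLaw π x 0 = Measure.dirac x := by
  ext s hs
  rw [stateLaw, ← lintegral_indicator_one hs, lintegral_map (measurable_one.indicator hs)
    (by fun_prop), M.lintegral_fst_zero_P π x (measurable_one.indicator hs),
    Measure.dirac_apply' _ hs]

theorem stateLaw_succ_stationary (κ : Kernel (XΔ X) (Ctrl A)) [IsMarkovKernel κ] (x : XΔ X) (n : ℕ)
    {Γ : Set (XΔ X)} (hΓ : MeasurableSet Γ) :
    M.stateLaw (Strategy.stationary κ) x (n + 1) Γ =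
      ∫⁻ y, κ y {b | M.next (y, b) ∈ Γ} ∂(M.stateLaw (Strategy.stationary κ) x n) := by
  have hi : Measurable (Γ.indicator (1 : XΔ X → ℝ≥0∞)) := measurable_one.indicator hΓ
  have hm : MeasurableSet (M.next ⁻¹' Γ) := M.measurable_next hΓ
  rw [stateLaw, stateLaw, ← lintegral_indicator_one hΓ, lintegral_map hi (by fun_prop),
    M.lintegral_fst_succ_P _ x n hi,
    M.lintegral_stationary_P κ x n (g := fun p => Γ.indicator 1 (M.next p))
      (hi.comp M.measurable_next),
    lintegral_map (f := fun y => κ y {b | M.next (y, b) ∈ Γ})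
      (Kernel.measurable_kernel_prodMk_left hm) (by fun_prop)]
  exact lintegral_congr fun ω => lintegral_indicator_one (measurable_prodMk_left hm)

theorem occupation_prod_univ (π : Strategy X A) (x : XΔ X) {Γ : Set (XΔ X)}
    (hΓ : MeasurableSet Γ) : M.occupation π x (Γ ×ˢ univ) = ∑' n, M.stateLaw π x n Γ := by
  rw [occupation, Measure.sum_apply _ (hΓ.prod .univ)]
  refine tsum_congr fun n => ?_
  rw [stateLaw, Measure.map_apply (by fun_prop) (hΓ.prod .univ), Measure.map_apply (by fun_prop) hΓ,
    prod_univ]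
  rfl

/-- If a stationary strategy never returns from `Wᶜ` to `W` and disintegrates `μ` on `W`, then its
occupation measure is dominated by `μ` on `W`. -/
theorem LPFeasible.sum_stateLaw_le (h : M.LPFeasible d x₀ μ) {W : Set (XΔ X)}
    (hW : MeasurableSet W) {κ : Kernel (XΔ X) (Ctrl A)} [IsMarkovKernel κ]
    (hκ : Disintegrates W (κ.comap Subtype.val measurable_subtype_coe) μ)
    (hstay : ∀ x ∉ W, κ x {b | M.next (x, b) ∈ W} = 0) (N : ℕ) {Γ : Set (XΔ X)} (hΓW : Γ ⊆ W)
    (hΓ : MeasurableSet Γ) :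
    ∑ n ∈ Finset.range N, M.stateLaw (Strategy.stationary κ) (Sum.inl x₀) n Γ ≤ μ (Γ ×ˢ univ) := by
  induction N generalizing Γ with
  | zero => simp
  | succ N ih =>
    have hm : MeasurableSet (M.next ⁻¹' Γ) := M.measurable_next hΓ
    let T : XΔ X → ℝ≥0∞ := fun y => κ y {b | M.next (y, b) ∈ Γ}
    let L : ℕ → Measure (XΔ X) := M.stateLaw (Strategy.stationary κ) (Sum.inl x₀)
    -- Transitions into `Γ` start only in `W`, so the state laws matter only there, where the
    -- induction hypothesis bounds their sum.
    have hT0 : ∀ y ∉ W, T y = 0 := fun y hy =>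
      measure_mono_null (fun b hb => hΓW hb) (hstay y hy)
    have hT : ∀ ν : Measure (XΔ X), ∫⁻ y, T y ∂ν = ∫⁻ y in W, T y ∂ν := fun ν => by
      rw [← lintegral_indicator hW]
      refine lintegral_congr fun y => ?_
      by_cases hy : y ∈ W <;> simp [hy, hT0]
    have hle : (∑ n ∈ Finset.range N, L n).restrict W ≤ (μ.map Prod.fst).restrict W := by
      refine Measure.le_iff.2 fun s hs => ?_
      rw [Measure.restrict_apply hs, Measure.restrict_apply hs, Measure.finsetSum_apply,
        Measure.map_apply measurable_fst (hs.inter hW), ← prod_univ]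
      exact ih inter_subset_right (hs.inter hW)
    -- The law of `X_0` matches the Dirac term of the balance equation; what remains is the mass
    -- moved into `Γ` in one step.
    rw [Finset.sum_range_succ', add_comm, stateLaw_zero, h.measure_prod_univ hΓ]
    gcongr
    calc ∑ n ∈ Finset.range N, M.stateLaw (Strategy.stationary κ) (Sum.inl x₀) (n + 1) Γ
        = ∑ n ∈ Finset.range N, ∫⁻ y, T y ∂(L n) :=
          Finset.sum_congr rfl fun n _ => stateLaw_succ_stationary κ _ n hΓ
      _ = ∫⁻ y in W, T y ∂(∑ n ∈ Finset.range N, L n) := by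
          rw [← lintegral_finsetSum_measure, hT]
      _ ≤ ∫⁻ y in W, T y ∂(μ.map Prod.fst) := lintegral_mono' hle le_rfl
      _ = μ ((fun p : W × Ctrl A => ((p.1 : XΔ X), p.2)) ''
            {p | M.next ((p.1 : XΔ X), p.2) ∈ Γ}) := by
          rw [← lintegral_subtype_comap hW]
          exact hκ _ ((measurableEmbedding_subtype_prod hW).measurable hm)
      _ ≤ μ (M.next ⁻¹' Γ) := measure_mono (by rintro _ ⟨p, hp, rfl⟩; exact hp)

end Model

theorem glue_apply_of_mem {W : Set (XΔ X)} (hW : MeasurableSet W) (φ : Kernel W (Ctrl A))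
    {f : XΔ X → Ctrl A} (hf : Measurable f) {x : XΔ X} (hx : x ∈ W) :
    glue hW φ f hf x = φ ⟨x, hx⟩ :=
  dif_pos hx

theorem glue_apply_of_notMem {W : Set (XΔ X)} (hW : MeasurableSet W) (φ : Kernel W (Ctrl A))
    {f : XΔ X → Ctrl A} (hf : Measurable f) {x : XΔ X} (hx : x ∉ W) :
    glue hW φ f hf x = Measure.dirac (f x) :=
  dif_neg hx

theorem glue_comap_val {W : Set (XΔ X)} (hW : MeasurableSet W) (φ : Kernel W (Ctrl A))
    {f : XΔ X → Ctrl A} (hf : Measurable f) :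
    (glue hW φ f hf).comap Subtype.val measurable_subtype_coe = φ := by
  ext x : 1
  exact glue_apply_of_mem hW φ hf x.2

end LinearProgram

end ImpulseControl

end

/-! ### Assembly of the proposition -/

theorem mainTheorem4
    {X : Type*} {A : Type*}
    [TopologicalSpace X] [MeasurableSpace X] [BorelSpace X] (hX : ImpulseControl.IsBorelSpace X)
    [TopologicalSpace A] [MeasurableSpace A] [BorelSpace A] (hA : ImpulseControl.IsBorelSpace A)
    {J : ℕ} (M : ImpulseControl.Model X A J) (d : Fin J → ℝ≥0) (x₀ : X)
    (hfeas : M.Consistent d x₀) (hcc : M.CompactContinuous)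
    (μ : Measure (ImpulseControl.XΔ X × ImpulseControl.Ctrl A))
    (hμ : M.LPFeasible d x₀ μ) (hμ_fin : M.FiniteValue μ) :
    ∃ hV : MeasurableSet M.V,
      SigmaFinite (μ.restrict (M.V ×ˢ univ)) ∧
      (∃ φ : Kernel M.V (ImpulseControl.Ctrl A),
        IsMarkovKernel φ ∧ ImpulseControl.Disintegrates M.V φ μ) ∧
      ∀ (φ : Kernel M.V (ImpulseControl.Ctrl A)) [IsMarkovKernel φ],
        ImpulseControl.Disintegrates M.V φ μ →
        ∀ (f : ImpulseControl.XΔ X → ImpulseControl.Ctrl A) (hf : M.IsOptimalSelector f),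
        ∀ Γ ⊆ M.V, MeasurableSet Γ →
          M.occupation
              (ImpulseControl.Strategy.stationary (ImpulseControl.glue hV φ f hf.measurable))
              (Sum.inl x₀) (Γ ×ˢ univ) ≤
            μ (Γ ×ˢ univ) := by
  have := hX.secondCountableTopology
  have := hA.secondCountableTopology
  have := hA.standardBorelSpace
  have := hfeas.nonempty_action
  obtain ⟨S, hSm, hSfin, hSV⟩ := hμ.exists_spanning hcc.measurable_sumCost hcc.measurable_valueIter
    (hμ.lintegral_sumCost_lt_top hμ_fin hcc.measurable_cost) fun _ => hcc.mem_V_iff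
  have hV : MeasurableSet M.V := hSV ▸ MeasurableSet.iUnion hSm
  have := ImpulseControl.Model.sigmaFinite_comap_of_spanning hSm hSfin hSV
  refine ⟨hV, ImpulseControl.Model.sigmaFinite_restrict_of_spanning hSm hSfin hSV,
    ImpulseControl.exists_disintegrates hV, fun φ _ hφ f hf Γ hΓV hΓ => ?_⟩
  rw [ImpulseControl.Model.occupation_prod_univ _ _ hΓ]
  refine ENNReal.tsum_le_of_sum_range_le fun N => hμ.sum_stateLaw_le hV ?_ (fun x hx => ?_) N hΓV hΓ
  · rwa [ImpulseControl.glue_comap_val]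
  -- With both `Q` and the control Dirac, `stays` says that `next (x, f x)` is not in `V`.
  · have h := hf.stays x hx
    rw [ImpulseControl.Model.Q, Kernel.deterministic_apply, Measure.dirac_apply' _ hV] at h
    have hm : MeasurableSet {b | M.next (x, b) ∈ M.V} :=
      (M.measurable_next.comp measurable_prodMk_left) hV
    rw [ImpulseControl.glue_apply_of_notMem hV φ hf.measurable hx, Measure.dirac_apply' _ hm]
    exact h
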